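/- Let $V$ be a finite dimensional real vector space and $W\subset GL(V)$ a finite reflection group, i.e. a finite subgroup generated by linear reflections. Let $\mathcal A$ be the set of reflecting hyperplanes of $W$ (the fixed spaces of the reflections in $W$), and let $\mathcal H$, the Coxeter arrangement system, be the set of all intersections of elements of $\mathcal A$, the empty intersection being $V$. The Coxeter arrangement monoid is $$M(W,\mathcal H)=\{g_X \mid g\in W,\ X\in\mathcal H\},$$ where $g_X$ is the restriction of $g$ to the subspace $X$; it is a submonoid of the monoid $ML(V)$ of all linear isomorphisms between subspaces of $V$, under composition of partial functions. For a subspace $X$ let $W_X=\{g\in W\mid gv=v \text{ for all } v\in X\}$. There are an inner product on $V$, a root system $\Phi\subset V$ (a finite set of nonzero vectors with $\Phi\cap\mathbb R v=\{v,-v\}$ and $s_v\Phi=\Phi$ for all $v\in\Phi$, where $s_v$ is the reflection in the hyperplane orthogonal to $v$) such that $W=\langle s_v\mid v\in\Phi\rangle$, and a simple system $\Delta\subset\Phi$ (a linearly independent subset such that each element of $\Phi$ is a linear combination of $\Delta$ with coefficients all $\ge 0$ or all $\le 0$). For every such choice, let the parabolic subgroups of $W$ be the $W$-conjugates of the subgroups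 $W_I=\langle s_v\mid v\in I\rangle$, $I\subset\Delta$. Then $X\mapsto W_X$ is a bijection from $\mathcal H$ onto the set of parabolic subgroups of $W$, and $$|M(W,\mathcal H)|=\sum_{P}\,[W:P],$$ the sum being over all parabolic subgroups $P$ of $W$. -/

import Mathlib

open scoped NNReal

/-! ## The general linear monoid of partial linear isomorphisms -/

/-- A partial linear isomorphism of `V`: a linear isomorphism between two subspaces of `V`. -/
structure PartialLinearIso (k V : Type*) [Field k] [AddCommGroup V] [Module k V] where
  /-- the domain -/
  dom : Submodule k V
  /-- the image -/
  cod : Submodule k V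
  /-- the isomorphism from the domain onto the image -/
  equiv : dom ≃ₗ[k] cod

namespace PartialLinearIso

variable {k V : Type*} [Field k] [AddCommGroup V] [Module k V]

/-- Two partial isomorphisms with the same domain and the same values are equal. -/
theorem ext' {a b : PartialLinearIso k V} (h : a.dom = b.dom)
    (he : ∀ (x : V) (hx : x ∈ a.dom) (hx' : x ∈ b.dom),
      (a.equiv ⟨x, hx⟩ : V) = b.equiv ⟨x, hx'⟩) : a = b := by
  obtain ⟨Y, Z, e⟩ := a
  obtain ⟨Y', Z', e'⟩ := b
  obtain rfl : Y = Y' := h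
  have he' : ∀ x : Y, (e x : V) = e' x := fun x => he x.1 x.2 x.2
  obtain rfl : Z = Z' := by
    ext z
    constructor
    · intro hz
      have h1 := he' (e.symm ⟨z, hz⟩)
      rw [e.apply_symm_apply] at h1
      change z = _ at h1
      rw [h1]
      exact (e' _).2
    · intro hz
      have h1 := he' (e'.symm ⟨z, hz⟩)
      rw [e'.apply_symm_apply] at h1
      change _ = z at h1
      rw [← h1]
      exact (e _).2
  obtain rfl : e = e' := LinearEquiv.ext fun x => Subtype.ext (he' x)
  rfl

/-- The partial isomorphism given by an injective linear map defined on a subspace. -/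
noncomputable def ofInjective (Y : Submodule k V) (f : Y →ₗ[k] V) (hf : Function.Injective f) :
    PartialLinearIso k V where
  dom := Y
  cod := LinearMap.range f
  equiv := LinearEquiv.ofInjective f hf

/-- The domain of the composite of partial functions `a ∘ b` (first `b`, then `a`): the set of
`x` in the domain of `b` such that `b x` lies in the domain of `a`. -/
def compDom (a b : PartialLinearIso k V) : Submodule k V where
  carrier := {x | ∃ h : x ∈ b.dom, (b.equiv ⟨x, h⟩ : V) ∈ a.dom}
  zero_mem' := ⟨b.dom.zero_mem, by
    rw [show (⟨0, b.dom.zero_mem⟩ : b.dom) = 0 from rfl, map_zero]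
    exact a.dom.zero_mem⟩
  add_mem' := by
    rintro x y ⟨hx, hx'⟩ ⟨hy, hy'⟩
    refine ⟨b.dom.add_mem hx hy, ?_⟩
    rw [show (⟨x + y, b.dom.add_mem hx hy⟩ : b.dom) = ⟨x, hx⟩ + ⟨y, hy⟩ from rfl, map_add]
    exact a.dom.add_mem hx' hy'
  smul_mem' := by
    rintro c x ⟨hx, hx'⟩
    refine ⟨b.dom.smul_mem c hx, ?_⟩
    rw [show (⟨c • x, b.dom.smul_mem c hx⟩ : b.dom) = c • ⟨x, hx⟩ from rfl, map_smul]
    exact a.dom.smul_mem c hx'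

theorem compDom_le (a b : PartialLinearIso k V) : compDom a b ≤ b.dom := fun _ h => h.1

/-- The map `x ↦ a (b x)` on `compDom a b`. -/
def compMap (a b : PartialLinearIso k V) : compDom a b →ₗ[k] V where
  toFun x := a.equiv ⟨b.equiv ⟨x, x.2.1⟩, x.2.2⟩
  map_add' x y := by
    rw [← Submodule.coe_add, ← map_add]
    congr 2
    apply Subtype.ext
    change _ = ((b.equiv ⟨x, x.2.1⟩ + b.equiv ⟨y, y.2.1⟩ : b.cod) : V)
    rw [← map_add]
    rfl
  map_smul' c x := by
    rw [RingHom.id_apply, ← Submodule.coe_smul, ← map_smul]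
    congr 2
    apply Subtype.ext
    change _ = ((c • b.equiv ⟨x, x.2.1⟩ : b.cod) : V)
    rw [← map_smul]
    rfl

theorem compMap_injective (a b : PartialLinearIso k V) : Function.Injective (compMap a b) := by
  intro x y h
  have h1 := congrArg Subtype.val (a.equiv.injective (Subtype.ext h))
  have h2 := congrArg Subtype.val (b.equiv.injective (Subtype.ext h1))
  exact Subtype.ext h2

noncomputable instance : Mul (PartialLinearIso k V) :=
  ⟨fun a b => ofInjective (compDom a b) (compMap a b) (compMap_injective a b)⟩

instance : One (PartialLinearIso k V) := ⟨⟨⊤, ⊤, LinearEquiv.refl k _⟩⟩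

theorem mem_dom_mul {a b : PartialLinearIso k V} {x : V} :
    x ∈ (a * b).dom ↔ ∃ h : x ∈ b.dom, (b.equiv ⟨x, h⟩ : V) ∈ a.dom := Iff.rfl

theorem mul_apply {a b : PartialLinearIso k V} {x : V} (h : x ∈ (a * b).dom) :
    ((a * b).equiv ⟨x, h⟩ : V) = a.equiv ⟨b.equiv ⟨x, h.1⟩, h.2⟩ := rfl

/-- The general linear monoid `ML(V)`: the partial linear isomorphisms of `V` under composition of
partial functions. -/
noncomputable instance : Monoid (PartialLinearIso k V) where
  mul_assoc a b c := by
    refine ext' ?_ ?_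
    · ext x
      constructor
      · rintro ⟨h, h', h''⟩
        exact ⟨⟨h, h'⟩, h''⟩
      · rintro ⟨⟨h, h'⟩, h''⟩
        exact ⟨h, h', h''⟩
    · intro x hx hx'
      rfl
  one_mul a := by
    refine ext' ?_ ?_
    · ext x
      exact ⟨fun h => h.1, fun h => ⟨h, trivial⟩⟩
    · intro x hx hx'
      rfl
  mul_one a := by
    refine ext' ?_ ?_
    · ext x
      exact ⟨fun h => h.2, fun h => ⟨trivial, h⟩⟩
    · intro x hx hx'
      rfl

/-- The restriction `g_Y` of a linear automorphism `g` of `V` to a subspace `Y`. -/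
def restrict (g : V ≃ₗ[k] V) (Y : Submodule k V) : PartialLinearIso k V where
  dom := Y
  cod := Y.map (g : V →ₗ[k] V)
  equiv := g.submoduleMap Y

theorem restrict_mul_restrict (g h : V ≃ₗ[k] V) (Y Z : Submodule k V) :
    restrict g Y * restrict h Z =
      restrict (g * h) (Z ⊓ Y.map ((h⁻¹ : V ≃ₗ[k] V) : V →ₗ[k] V)) := by
  refine ext' ?_ ?_
  · ext x
    change (∃ _ : x ∈ Z, h x ∈ Y) ↔ (x ∈ Z ∧ ∃ y ∈ Y, h⁻¹ y = x)
    constructor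
    · rintro ⟨h1, h2⟩
      exact ⟨h1, h x, h2, h.symm_apply_apply x⟩
    · rintro ⟨h1, y, hy, rfl⟩
      refine ⟨h1, ?_⟩
      have : h (h⁻¹ y) = y := h.apply_symm_apply y
      rwa [this]
  · intro x hx hx'
    rfl

end PartialLinearIso

/-! ## Systems of subspaces and monoids of partial linear isomorphisms -/

section Systems

variable {k V : Type*} [Field k] [AddCommGroup V] [Module k V]

/-- A system of subspaces in `V` for `G ⊆ GL(V)`. -/
structure IsSystem (G : Subgroup (V ≃ₗ[k] V)) (S : Set (Submodule k V)) : Prop where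
  top_mem : ⊤ ∈ S
  map_mem : ∀ g ∈ G, ∀ X ∈ S, X.map (g : V →ₗ[k] V) ∈ S
  inf_mem : ∀ X ∈ S, ∀ Y ∈ S, X ⊓ Y ∈ S

/-- The monoid `M(G, S) = {g_X | g ∈ G, X ∈ S}`, as a submonoid of `ML(V)`. -/
noncomputable def partialIsoMonoid (G : Subgroup (V ≃ₗ[k] V)) (S : Set (Submodule k V))
    (hS : IsSystem G S) : Submonoid (PartialLinearIso k V) where
  carrier := {a | ∃ g ∈ G, ∃ X ∈ S, a = PartialLinearIso.restrict g X}
  one_mem' := ⟨1, G.one_mem, ⊤, hS.top_mem, PartialLinearIso.ext' rfl fun _ _ _ => rfl⟩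
  mul_mem' := by
    rintro _ _ ⟨g, hg, X, hX, rfl⟩ ⟨h, hh, Y, hY, rfl⟩
    exact ⟨g * h, G.mul_mem hg hh, _,
      hS.inf_mem _ hY _ (hS.map_mem _ (G.inv_mem hh) _ hX),
      PartialLinearIso.restrict_mul_restrict g h X Y⟩

end Systems

/-! ## Reflection groups and their arrangements -/

section Reflections

variable {V : Type*} [AddCommGroup V] [Module ℝ V]

/-- A linear reflection of a real vector space: it negates a vector `x` and fixes pointwise the
hyperplane `ker f`, which does not contain `x` since `f x = 2`. -/
def IsLinearReflection (s : V ≃ₗ[ℝ] V) : Prop :=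
  ∃ (x : V) (f : Module.Dual ℝ V) (h : f x = 2), s = Module.reflection h

/-- `W ⊆ GL(V)` is generated by linear reflections. -/
def IsReflectionGroup (W : Subgroup (V ≃ₗ[ℝ] V)) : Prop :=
  ∃ R : Set (V ≃ₗ[ℝ] V), (∀ s ∈ R, IsLinearReflection s) ∧ Subgroup.closure R = W

/-- The reflecting hyperplanes of `W`: the fixed spaces of the reflections in `W`. -/
def reflectingHyperplanes (W : Subgroup (V ≃ₗ[ℝ] V)) : Set (Submodule ℝ V) :=
  {X | ∃ s ∈ W, IsLinearReflection s ∧ X = LinearMap.fixedSubmodule (s : V →ₗ[ℝ] V)}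

/-- The intersection lattice of a collection `A` of subspaces: all possible intersections of
elements of `A`, the empty intersection being `V`. -/
def intersectionLattice (A : Set (Submodule ℝ V)) : Set (Submodule ℝ V) :=
  {X | ∃ B ⊆ A, X = sInf B}

/-- The Coxeter arrangement system of `W`. -/
def coxeterSystem (W : Subgroup (V ≃ₗ[ℝ] V)) : Set (Submodule ℝ V) :=
  intersectionLattice (reflectingHyperplanes W)

theorem IsLinearReflection.conj {s : V ≃ₗ[ℝ] V} (hs : IsLinearReflection s) (g : V ≃ₗ[ℝ] V) :
    IsLinearReflection (g * s * g⁻¹) := by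
  obtain ⟨x, f, h, rfl⟩ := hs
  have hinv : ∀ y, g (g⁻¹ y) = y := g.apply_symm_apply
  have hinv' : ∀ y, g⁻¹ (g y) = y := g.symm_apply_apply
  refine ⟨g x, f ∘ₗ ((g⁻¹ : V ≃ₗ[ℝ] V) : V →ₗ[ℝ] V), ?_, ?_⟩
  · change f (g⁻¹ (g x)) = 2
    rw [hinv', h]
  · ext y
    rw [Module.reflection_apply]
    change g (Module.reflection h (g⁻¹ y)) = y - f (g⁻¹ y) • g x
    rw [Module.reflection_apply, map_sub, map_smul, hinv]

theorem map_mem_reflectingHyperplanes {W : Subgroup (V ≃ₗ[ℝ] V)} {g : V ≃ₗ[ℝ] V} (hg : g ∈ W)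
    {X : Submodule ℝ V} (hX : X ∈ reflectingHyperplanes W) :
    X.map (g : V →ₗ[ℝ] V) ∈ reflectingHyperplanes W := by
  obtain ⟨s, hs, hr, rfl⟩ := hX
  refine ⟨g * s * g⁻¹, W.mul_mem (W.mul_mem hg hs) (W.inv_mem hg), hr.conj g, ?_⟩
  have hinv : ∀ y, g (g⁻¹ y) = y := g.apply_symm_apply
  have hinv' : ∀ y, g⁻¹ (g y) = y := g.symm_apply_apply
  ext y
  change (∃ x, s x = x ∧ g x = y) ↔ g (s (g⁻¹ y)) = y
  constructor
  · rintro ⟨x, hx, rfl⟩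
    rw [hinv', hx]
  · intro h
    refine ⟨g⁻¹ y, ?_, hinv y⟩
    apply g.injective
    rw [h, hinv]

theorem isSystem_coxeterSystem (W : Subgroup (V ≃ₗ[ℝ] V)) : IsSystem W (coxeterSystem W) where
  top_mem := ⟨∅, Set.empty_subset _, sInf_empty.symm⟩
  map_mem := by
    rintro g hg _ ⟨B, hB, rfl⟩
    refine ⟨(fun X => X.map (g : V →ₗ[ℝ] V)) '' B, ?_, ?_⟩
    · rintro _ ⟨X, hX, rfl⟩
      exact map_mem_reflectingHyperplanes hg (hB hX)
    · have hinv : ∀ y, g (g⁻¹ y) = y := g.apply_symm_apply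
      ext y
      simp only [Submodule.mem_map, Submodule.mem_sInf, Set.mem_image, forall_exists_index,
        and_imp, forall_apply_eq_imp_iff₂]
      constructor
      · rintro ⟨x, hx, rfl⟩ X hX
        exact ⟨x, hx X hX, rfl⟩
      · intro h
        refine ⟨g⁻¹ y, fun X hX => ?_, hinv y⟩
        obtain ⟨x, hx, rfl⟩ := h X hX
        have : g⁻¹ (g x) = x := g.symm_apply_apply x
        change g⁻¹ (g x) ∈ X
        rwa [this]
  inf_mem := by
    rintro _ ⟨B, hB, rfl⟩ _ ⟨C, hC, rfl⟩
    exact ⟨B ∪ C, Set.union_subset hB hC, sInf_union.symm⟩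

/-- The Coxeter arrangement monoid `M(W, H)`. -/
noncomputable def coxeterArrangementMonoid (W : Subgroup (V ≃ₗ[ℝ] V)) :
    Submonoid (PartialLinearIso ℝ V) :=
  partialIsoMonoid W (coxeterSystem W) (isSystem_coxeterSystem W)

/-! ## Root systems, simple systems and parabolic subgroups -/

/-- `B` is an inner product (a positive definite symmetric bilinear form) on `V`. -/
def IsInnerProduct (B : LinearMap.BilinForm ℝ V) : Prop :=
  (∀ x y, B x y = B y x) ∧ ∀ x, x ≠ 0 → 0 < B x x

/-- `s` is the reflection `s_v` in the hyperplane that is orthogonal to `v` for `B`. -/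
def IsReflectionOf (B : LinearMap.BilinForm ℝ V) (v : V) (s : V ≃ₗ[ℝ] V) : Prop :=
  ∀ x, s x = x - (2 * B x v / B v v) • v

/-- `Φ` is a (reduced, not necessarily crystallographic) root system in the Euclidean space
`(V, B)`: a finite set of nonzero vectors which meets each line that it spans in a pair `±v` and is
stable under the reflections in its elements. -/
structure IsRootSystem (B : LinearMap.BilinForm ℝ V) (Φ : Set V) : Prop where
  finite : Φ.Finite
  zero_notMem : (0 : V) ∉ Φ
  line : ∀ v ∈ Φ, Φ ∩ (Submodule.span ℝ {v} : Set V) = {v, -v}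
  reflection_mem : ∀ v ∈ Φ, ∀ s, IsReflectionOf B v s → s '' Φ = Φ

/-- `Δ` is a simple system in `Φ`: a linearly independent subset such that each element of `Φ` is a
linear combination of `Δ` with coefficients that are all nonnegative or all nonpositive. -/
structure IsSimpleSystem (Φ Δ : Set V) : Prop where
  subset : Δ ⊆ Φ
  linearIndepOn : LinearIndepOn ℝ id Δ
  nonneg_or_nonpos : ∀ v ∈ Φ, v ∈ Submodule.span ℝ≥0 Δ ∨ -v ∈ Submodule.span ℝ≥0 Δ

/-- The subgroup of `GL(V)` generated by the reflections `s_v` with `v ∈ I`. -/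
def reflectionSubgroup (B : LinearMap.BilinForm ℝ V) (I : Set V) : Subgroup (V ≃ₗ[ℝ] V) :=
  Subgroup.closure {s | ∃ v ∈ I, IsReflectionOf B v s}

/-- A presentation `W = W(Φ)` of `W` by a root system `Φ` in a Euclidean space `(V, B)`, together
with a simple system `Δ ⊆ Φ`. -/
structure IsRootDatum (W : Subgroup (V ≃ₗ[ℝ] V)) (B : LinearMap.BilinForm ℝ V) (Φ Δ : Set V) :
    Prop where
  innerProduct : IsInnerProduct B
  rootSystem : IsRootSystem B Φ
  generates : reflectionSubgroup B Φ = W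
  simpleSystem : IsSimpleSystem Φ Δ

/-- The special parabolic subgroup `W_I = ⟨s_v | v ∈ I⟩`, as a subgroup of `W`. -/
def specialParabolic (W : Subgroup (V ≃ₗ[ℝ] V)) (B : LinearMap.BilinForm ℝ V) (I : Set V) :
    Subgroup W :=
  (reflectionSubgroup B I).subgroupOf W

/-- The parabolic subgroups of `W`: the `W`-conjugates of the special parabolic subgroups `W_I`,
`I ⊆ Δ`. -/
def parabolicSubgroups (W : Subgroup (V ≃ₗ[ℝ] V)) (B : LinearMap.BilinForm ℝ V) (Δ : Set V) :
    Set (Subgroup W) :=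
  {P | ∃ I ⊆ Δ, ∃ w : W, P = (specialParabolic W B I).map (MulAut.conj w).toMonoidHom}

/-- The isotropy group `W_X = {g ∈ W | g v = v for all v ∈ X}`. -/
def isotropyGroup (W : Subgroup (V ≃ₗ[ℝ] V)) (X : Submodule ℝ V) : Subgroup W :=
  fixingSubgroup W (X : Set V)

theorem mem_isotropyGroup {W : Subgroup (V ≃ₗ[ℝ] V)} {X : Submodule ℝ V} {g : W} :
    g ∈ isotropyGroup W X ↔ ∀ v ∈ X, (g : V ≃ₗ[ℝ] V) v = v :=
  mem_fixingSubgroup_iff W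

end Reflections

/-! Two restrictions `g_X` and `h_Y` coincide exactly when `X = Y` and `g`, `h` lie in the same left
coset of `W_X`. So the monoid is the disjoint union of the coset spaces `W / W_X`, and the count
reduces to the bijection `X ↦ W_X` (`card_partialIsoMonoid`).

Injectivity holds because a member of the system is the fixed space of its isotropy group. The link
with parabolic subgroups rests on `fixes_iff`: by the exchange condition, the stabilizer of a
dominant vector is generated by the simple reflections fixing it. A generic vector of `X` has
stabilizer `W_X` and can be moved into the closed chamber, so `W_X` is parabolic. Conversely, a
dominant vector orthogonal to exactly the simple roots in `I` exhibits `W_I` as an isotropy group,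
and conjugation gives the rest.

A root datum exists by averaging an inner product, taking the unit normals of the reflections in
`W`, and choosing a minimal generating set of the cone of positive roots. -/

/-! ### Orthogonal reflections and their products -/

section RootReflection

variable {V : Type*} [AddCommGroup V] [Module ℝ V] {B : LinearMap.BilinForm ℝ V}

/-- The orthogonal reflection in the vector `v`, with respect to the bilinear form `B`
(the identity if `v` is isotropic). -/
noncomputable def rootReflection (B : LinearMap.BilinForm ℝ V) (v : V) : V ≃ₗ[ℝ] V :=
  LinearEquiv.ofInvolutive (LinearMap.id - ((2 / B v v) • B.flip v).smulRight v) <| by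
    intro x
    rcases eq_or_ne (B v v) 0 with h | h
    · simp [h]
    · have : 2 / B v v * B.flip v v = 2 := div_mul_cancel₀ 2 h
      simp only [LinearMap.sub_apply, LinearMap.id_apply, LinearMap.smulRight_apply,
        LinearMap.smul_apply, map_sub, map_smul, smul_eq_mul, this]
      module

theorem rootReflection_apply (v x : V) :
    rootReflection B v x = x - (2 * B x v / B v v) • v := by
  change x - ((2 / B v v) * B x v) • v = _
  congr 2
  ring

theorem isReflectionOf_iff {v : V} {s : V ≃ₗ[ℝ] V} :
    IsReflectionOf B v s ↔ s = rootReflection B v := by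
  constructor
  · intro h
    ext x
    rw [h x, rootReflection_apply]
  · rintro rfl x
    exact rootReflection_apply v x

theorem rootReflection_mul_self (v : V) : rootReflection B v * rootReflection B v = 1 :=
  (rootReflection B v).self_trans_symm

theorem rootReflection_apply_apply (v x : V) :
    rootReflection B v (rootReflection B v x) = x :=
  (rootReflection B v).symm_apply_apply x

theorem rootReflection_self {v : V} (h : B v v ≠ 0) : rootReflection B v v = -v := by
  rw [rootReflection_apply, mul_div_cancel_right₀ _ h]
  module

theorem rootReflection_neg (v : V) : rootReflection B (-v) = rootReflection B v := by
  ext x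
  simp [rootReflection_apply, neg_div]

theorem rootReflection_smul {c : ℝ} (hc : c ≠ 0) (v : V) :
    rootReflection B (c • v) = rootReflection B v := by
  ext x
  rw [rootReflection_apply, rootReflection_apply, smul_smul]
  congr 2
  simp only [map_smul, LinearMap.smul_apply, smul_eq_mul]
  rcases eq_or_ne (B v v) 0 with h | h
  · simp [h]
  · field_simp

theorem rootReflection_eq_self_iff {v x : V} (h : B v v ≠ 0) :
    rootReflection B v x = x ↔ B x v = 0 := by
  have hv : v ≠ 0 := by
    rintro rfl
    simp at h
  rw [rootReflection_apply, sub_eq_self, smul_eq_zero, or_iff_left hv, div_eq_zero_iff,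
    or_iff_left h]
  simp

theorem rootReflection_isometry (hB : ∀ x y, B x y = B y x) (v x y : V) :
    B (rootReflection B v x) (rootReflection B v y) = B x y := by
  rcases eq_or_ne (B v v) 0 with h | h
  · simp [rootReflection_apply, h]
  · simp only [rootReflection_apply, map_sub, map_smul, LinearMap.sub_apply, LinearMap.smul_apply,
      smul_eq_mul, hB v y]
    field_simp
    ring

theorem conj_rootReflection {g : V ≃ₗ[ℝ] V} (hg : ∀ x y, B (g x) (g y) = B x y) (v : V) :
    g * rootReflection B v * g⁻¹ = rootReflection B (g v) := by
  ext x
  have hinv : g (g⁻¹ x) = x := g.apply_symm_apply x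
  change g (rootReflection B v (g⁻¹ x)) = _
  rw [rootReflection_apply, rootReflection_apply, hg, map_sub, map_smul, hinv,
    ← hg (g⁻¹ x), hinv]

theorem isLinearReflection_rootReflection {v : V} (h : B v v ≠ 0) :
    IsLinearReflection (rootReflection B v) := by
  refine ⟨v, (2 / B v v) • B.flip v, show 2 / B v v * B v v = 2 from div_mul_cancel₀ 2 h, ?_⟩
  ext x
  exact (Module.reflection_apply (x := v) (f := (2 / B v v) • B.flip v) x _).symm

theorem reflectionSubgroup_eq (B : LinearMap.BilinForm ℝ V) (I : Set V) :
    reflectionSubgroup B I = Subgroup.closure (rootReflection B '' I) := by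
  unfold reflectionSubgroup
  congr 1
  ext s
  simp [isReflectionOf_iff, eq_comm]

theorem rootReflection_mem_reflectionSubgroup {I : Set V} {v : V} (hv : v ∈ I) :
    rootReflection B v ∈ reflectionSubgroup B I := by
  rw [reflectionSubgroup_eq]
  exact Subgroup.subset_closure ⟨v, hv, rfl⟩

theorem reflectionSubgroup_le {I : Set V} {G : Subgroup (V ≃ₗ[ℝ] V)}
    (h : ∀ v ∈ I, rootReflection B v ∈ G) : reflectionSubgroup B I ≤ G := by
  rw [reflectionSubgroup_eq, Subgroup.closure_le]
  rintro _ ⟨v, hv, rfl⟩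
  exact h v hv

/-- The product of the reflections in the vectors of a list. -/
noncomputable def reflectionProd (B : LinearMap.BilinForm ℝ V) (l : List V) : V ≃ₗ[ℝ] V :=
  (l.map (rootReflection B)).prod

theorem reflectionProd_nil : reflectionProd B [] = 1 := rfl

theorem reflectionProd_cons (v : V) (l : List V) :
    reflectionProd B (v :: l) = rootReflection B v * reflectionProd B l := by
  simp [reflectionProd]

theorem reflectionProd_append (l l' : List V) :
    reflectionProd B (l ++ l') = reflectionProd B l * reflectionProd B l' := by
  simp [reflectionProd]

theorem reflectionProd_isometry (hB : ∀ x y, B x y = B y x) (l : List V) (x y : V) :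
    B (reflectionProd B l x) (reflectionProd B l y) = B x y := by
  induction l with
  | nil => rfl
  | cons v l ih =>
    rw [reflectionProd_cons]
    exact (rootReflection_isometry hB v _ _).trans ih

theorem exists_reflectionProd_eq {I : Set V} {g : V ≃ₗ[ℝ] V} (hg : g ∈ reflectionSubgroup B I) :
    ∃ l : List V, (∀ v ∈ l, v ∈ I) ∧ reflectionProd B l = g := by
  rw [reflectionSubgroup_eq] at hg
  induction hg using Subgroup.closure_induction_left with
  | one => exact ⟨[], by simp, rfl⟩
  | mul_left x hx y _ ih =>
    obtain ⟨v, hv, rfl⟩ := hx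
    obtain ⟨l, hl, rfl⟩ := ih
    exact ⟨v :: l, by simpa using ⟨hv, hl⟩, reflectionProd_cons v l⟩
  | inv_mul_cancel x hx y _ ih =>
    obtain ⟨v, hv, rfl⟩ := hx
    obtain ⟨l, hl, rfl⟩ := ih
    exact ⟨v :: l, by simpa using ⟨hv, hl⟩, reflectionProd_cons v l⟩

end RootReflection

/-! ### Nonnegative cones and coordinate functionals -/

section Cone

variable {V : Type*} [AddCommGroup V] [Module ℝ V] {Δ : Set V}

theorem Module.Dual.nonneg_of_mem_span_nnreal {f : Module.Dual ℝ V} (hf : ∀ δ ∈ Δ, 0 ≤ f δ) {v : V}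
    (hv : v ∈ Submodule.span ℝ≥0 Δ) : 0 ≤ f v := by
  induction hv using Submodule.span_induction with
  | mem x hx => exact hf x hx
  | zero => simp
  | add x y _ _ hx hy => rw [map_add]; exact add_nonneg hx hy
  | smul c x _ hx =>
    rw [NNReal.smul_def, map_smul]
    exact mul_nonneg c.2 hx

/-- The alternative `v = 0` makes the statement stable under sums and nonnegative scalings; it shows
that the cone is pointed. -/
theorem Module.Dual.eq_zero_or_pos_of_mem_span_nnreal {f : Module.Dual ℝ V}
    (hf : ∀ δ ∈ Δ, 0 < f δ) {v : V} (hv : v ∈ Submodule.span ℝ≥0 Δ) : v = 0 ∨ 0 < f v := by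
  induction hv using Submodule.span_induction with
  | mem x hx => exact .inr (hf x hx)
  | zero => exact .inl rfl
  | add x y _ _ hx hy =>
    rcases hx with rfl | hx
    · simpa using hy
    · rcases hy with rfl | hy
      · simpa using Or.inr hx
      · rw [map_add]
        exact .inr (add_pos hx hy)
  | smul c x _ hx =>
    rcases hx with rfl | hx
    · simp
    · rcases eq_or_ne c 0 with rfl | hc
      · simp
      · rw [NNReal.smul_def, map_smul]
        exact .inr (mul_pos (NNReal.coe_pos.2 (pos_iff_ne_zero.2 hc)) hx)

theorem span_nnreal_subset_span (Δ : Set V) {v : V} (hv : v ∈ Submodule.span ℝ≥0 Δ) :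
    v ∈ Submodule.span ℝ Δ :=
  Submodule.span_le_restrictScalars ℝ≥0 ℝ Δ hv

/-- Coordinate functionals for a linearly independent set. -/
theorem LinearIndepOn.exists_coord (h : LinearIndepOn ℝ id Δ) :
    ∃ f : V → Module.Dual ℝ V, (∀ δ ∈ Δ, f δ δ = 1) ∧ (∀ γ ∈ Δ, ∀ δ ∈ Δ, γ ≠ δ → f γ δ = 0) ∧
      ∀ u ∈ Submodule.span ℝ Δ, (∀ γ ∈ Δ, f γ u = 0) → u = 0 := by
  classical
  let b := Module.Basis.extend h
  have hsub : Δ ⊆ h.extend (Set.subset_univ _) := h.subset_extend _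
  have hb (δ) (hδ : δ ∈ Δ) : b.repr δ = Finsupp.single ⟨δ, hsub hδ⟩ 1 := by
    rw [← b.repr_self, Module.Basis.extend_apply_self]
  refine ⟨fun γ => if hγ : γ ∈ h.extend (Set.subset_univ _) then b.coord ⟨γ, hγ⟩ else 0,
    fun δ hδ => ?_, fun γ hγ δ hδ hne => ?_, fun u hu h0 => ?_⟩
  · simp [hsub hδ, hb δ hδ]
  · simp only [hsub hγ, dite_true, Module.Basis.coord_apply, hb δ hδ]
    exact Finsupp.single_eq_of_ne (by simpa using hne)
  · refine b.ext_elem fun i => ?_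
    rw [map_zero, Finsupp.zero_apply]
    by_cases hi : i.1 ∈ Δ
    · simpa [hsub hi] using h0 i hi
    · clear h0
      induction hu using Submodule.span_induction with
      | mem x hx =>
        rw [hb x hx]
        refine Finsupp.single_eq_of_ne ?_
        rintro rfl
        exact hi hx
      | zero => simp
      | add x y _ _ hx hy => simp [hx, hy]
      | smul c x _ hx => simp [hx]

end Cone

/-! ### Positive roots, the exchange condition and stabilizers of dominant vectors -/

namespace IsRootDatum

variable {V : Type*} [AddCommGroup V] [Module ℝ V]
  {W : Subgroup (V ≃ₗ[ℝ] V)} {B : LinearMap.BilinForm ℝ V} {Φ Δ : Set V}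

theorem symm (D : IsRootDatum W B Φ Δ) (x y : V) : B x y = B y x := D.innerProduct.1 x y

theorem ne_zero (D : IsRootDatum W B Φ Δ) {v : V} (hv : v ∈ Φ) : v ≠ 0 := by
  rintro rfl
  exact D.rootSystem.zero_notMem hv

theorem self_pos (D : IsRootDatum W B Φ Δ) {v : V} (hv : v ∈ Φ) : 0 < B v v :=
  D.innerProduct.2 v (D.ne_zero hv)

theorem neg_mem (D : IsRootDatum W B Φ Δ) {v : V} (hv : v ∈ Φ) : -v ∈ Φ := by
  have : -v ∈ Φ ∩ (Submodule.span ℝ {v} : Set V) := by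
    rw [D.rootSystem.line v hv]
    simp
  exact this.1

theorem rootReflection_mem (D : IsRootDatum W B Φ Δ) {v : V} (hv : v ∈ Φ) :
    rootReflection B v ∈ W := by
  rw [← D.generates]
  exact rootReflection_mem_reflectionSubgroup hv

theorem rootReflection_mem_roots (D : IsRootDatum W B Φ Δ) {v u : V} (hv : v ∈ Φ) (hu : u ∈ Φ) :
    rootReflection B v u ∈ Φ := by
  rw [← D.rootSystem.reflection_mem v hv _ (isReflectionOf_iff.2 rfl)]
  exact ⟨u, hu, rfl⟩

theorem isometry (D : IsRootDatum W B Φ Δ) {g : V ≃ₗ[ℝ] V} (hg : g ∈ W) (x y : V) :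
    B (g x) (g y) = B x y := by
  rw [← D.generates] at hg
  obtain ⟨l, -, rfl⟩ := exists_reflectionProd_eq hg
  exact reflectionProd_isometry D.symm l x y

theorem reflectionProd_mem_roots (D : IsRootDatum W B Φ Δ) {l : List V} (hl : ∀ v ∈ l, v ∈ Φ)
    {u : V} (hu : u ∈ Φ) : reflectionProd B l u ∈ Φ := by
  induction l with
  | nil => exact hu
  | cons v l ih =>
    rw [reflectionProd_cons]
    exact D.rootReflection_mem_roots (hl v (by simp)) (ih fun w hw => hl w (by simp [hw]))

/-- The height functional, which is `1` on every simple root. -/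
theorem exists_height (D : IsRootDatum W B Φ Δ) :
    ∃ f : Module.Dual ℝ V, ∀ δ ∈ Δ, f δ = 1 :=
  Module.exists_dual_forall_apply_eq_one D.simpleSystem.linearIndepOn

theorem neg_notMem_cone (D : IsRootDatum W B Φ Δ) {v : V} (hv : v ≠ 0)
    (h : v ∈ Submodule.span ℝ≥0 Δ) : -v ∉ Submodule.span ℝ≥0 Δ := by
  obtain ⟨f, hf⟩ := D.exists_height
  have hf' : ∀ δ ∈ Δ, 0 < f δ := fun δ hδ => by rw [hf δ hδ]; exact one_pos
  intro h'
  have h1 := (Module.Dual.eq_zero_or_pos_of_mem_span_nnreal hf' h).resolve_left hv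
  have h2 := (Module.Dual.eq_zero_or_pos_of_mem_span_nnreal hf' h').resolve_left (by simpa using hv)
  rw [map_neg] at h2
  linarith

/-- A simple reflection permutes the positive roots other than the simple root itself. -/
theorem rootReflection_mem_cone (D : IsRootDatum W B Φ Δ) {δ β : V} (hδ : δ ∈ Δ) (hβ : β ∈ Φ)
    (hpos : β ∈ Submodule.span ℝ≥0 Δ) (hne : β ≠ δ) :
    rootReflection B δ β ∈ Submodule.span ℝ≥0 Δ := by
  have hδΦ := D.simpleSystem.subset hδ
  refine (D.simpleSystem.nonneg_or_nonpos _ (D.rootReflection_mem_roots hδΦ hβ)).resolve_right ?_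
  intro hneg
  obtain ⟨f, hf1, hf0, hf⟩ := D.simpleSystem.linearIndepOn.exists_coord
  have hnn : ∀ γ ∈ Δ, ∀ δ ∈ Δ, 0 ≤ f γ δ := by
    intro γ hγ δ hδ
    rcases eq_or_ne γ δ with rfl | h
    · rw [hf1 γ hγ]; exact zero_le_one
    · rw [hf0 γ hγ δ hδ h]
  -- The reflection changes only the `δ`-coordinate. If the image were negative, every other
  -- coordinate of `β` would be both nonnegative and nonpositive, leaving a multiple of `δ`.
  have hβδ : β = f δ β • δ := by
    rw [← sub_eq_zero]
    refine hf _ (Submodule.sub_mem _ (span_nnreal_subset_span _ hpos)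
      (Submodule.smul_mem _ _ (Submodule.subset_span hδ))) fun γ hγ => ?_
    rw [map_sub, map_smul, smul_eq_mul]
    rcases eq_or_ne γ δ with rfl | h
    · rw [hf1 γ hγ]; ring
    · have h1 := Module.Dual.nonneg_of_mem_span_nnreal (hnn γ hγ) hpos
      have h2 := Module.Dual.nonneg_of_mem_span_nnreal (hnn γ hγ) hneg
      rw [rootReflection_apply, map_neg, map_sub, map_smul, hf0 γ hγ δ hδ h] at h2
      rw [hf0 γ hγ δ hδ h]
      simp only [smul_eq_mul, mul_zero, sub_zero] at h2 ⊢
      linarith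
  have hline : β ∈ Φ ∩ (Submodule.span ℝ {δ} : Set V) :=
    ⟨hβ, Submodule.mem_span_singleton.2 ⟨_, hβδ.symm⟩⟩
  rw [D.rootSystem.line δ hδΦ] at hline
  rcases hline with h | h
  · exact hne h
  · rw [Set.mem_singleton_iff] at h
    rw [h] at hpos
    exact D.neg_notMem_cone (D.ne_zero hδΦ) (Submodule.subset_span hδ) hpos

/-- Otherwise `-B v` is nonnegative on the simple roots, hence on the cone and at `v` itself,
against positive definiteness. -/
theorem exists_simple_pos (D : IsRootDatum W B Φ Δ) {v : V} (hv : v ≠ 0)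
    (hpos : v ∈ Submodule.span ℝ≥0 Δ) : ∃ δ ∈ Δ, 0 < B v δ := by
  by_contra! h
  have := Module.Dual.nonneg_of_mem_span_nnreal (f := -B v) (Δ := Δ)
    (fun δ hδ => by simpa using h δ hδ) hpos
  have h2 := D.innerProduct.2 v hv
  simp only [LinearMap.neg_apply] at this
  linarith

/-- Among the positive roots in the orbit of `β` under the simple reflections, one of least height
must be simple: otherwise reflecting it in a simple root with positive inner product keeps it
positive and lowers its height. Conjugating back gives the claim for `β`. -/
theorem rootReflection_mem_of_pos (D : IsRootDatum W B Φ Δ) {β : V} (hβ : β ∈ Φ)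
    (hpos : β ∈ Submodule.span ℝ≥0 Δ) : rootReflection B β ∈ reflectionSubgroup B Δ := by
  obtain ⟨f, hf⟩ := D.exists_height
  let S : Set V := {γ | γ ∈ Φ ∧ γ ∈ Submodule.span ℝ≥0 Δ ∧
    ∃ w ∈ reflectionSubgroup B Δ, w β = γ}
  have hS : S.Finite := D.rootSystem.finite.subset fun γ h => h.1
  obtain ⟨γ, ⟨hγΦ, hγpos, w, hw, hwγ⟩, hmin⟩ :=
    Set.exists_min_image S f hS ⟨β, hβ, hpos, 1, Subgroup.one_mem _, rfl⟩
  have hle : reflectionSubgroup B Δ ≤ W :=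
    reflectionSubgroup_le fun v hv => D.rootReflection_mem (D.simpleSystem.subset hv)
  suffices hγ : rootReflection B γ ∈ reflectionSubgroup B Δ by
    rw [← hwγ, ← conj_rootReflection (D.isometry (hle hw))] at hγ
    rw [show rootReflection B β = w⁻¹ * (w * rootReflection B β * w⁻¹) * w by group]
    exact Subgroup.mul_mem _ (Subgroup.mul_mem _ (Subgroup.inv_mem _ hw) hγ) hw
  obtain ⟨δ, hδ, hδpos⟩ := D.exists_simple_pos (D.ne_zero hγΦ) hγpos
  have hδΦ := D.simpleSystem.subset hδ
  rcases eq_or_ne γ δ with rfl | hne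
  · exact rootReflection_mem_reflectionSubgroup hδ
  · have := hmin (rootReflection B δ γ) ⟨D.rootReflection_mem_roots hδΦ hγΦ,
      D.rootReflection_mem_cone hδ hγΦ hγpos hne, rootReflection B δ * w,
      Subgroup.mul_mem _ (rootReflection_mem_reflectionSubgroup hδ) hw, by
        change rootReflection B δ (w β) = _
        rw [hwγ]⟩
    rw [rootReflection_apply, map_sub, map_smul, hf δ hδ] at this
    have h2 : 0 < 2 * B γ δ / B δ δ := div_pos (by linarith) (D.self_pos hδΦ)
    simp only [smul_eq_mul, mul_one] at this
    linarith

/-- The simple reflections generate `W`. -/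
theorem reflectionSubgroup_simple (D : IsRootDatum W B Φ Δ) : reflectionSubgroup B Δ = W := by
  apply le_antisymm
  · exact reflectionSubgroup_le fun v hv => D.rootReflection_mem (D.simpleSystem.subset hv)
  · rw [← D.generates]
    refine reflectionSubgroup_le fun β hβ => ?_
    rcases D.simpleSystem.nonneg_or_nonpos β hβ with h | h
    · exact D.rootReflection_mem_of_pos hβ h
    · rw [← rootReflection_neg]
      exact D.rootReflection_mem_of_pos (D.neg_mem hβ) h

/-- If a product of simple reflections makes a positive root negative, then some terminal segment
of it maps that root to the simple root of the preceding factor. -/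
theorem exists_split (D : IsRootDatum W B Φ Δ) {l : List V} (hl : ∀ v ∈ l, v ∈ Δ) {β : V}
    (hβ : β ∈ Φ) (hpos : β ∈ Submodule.span ℝ≥0 Δ)
    (hneg : reflectionProd B l β ∉ Submodule.span ℝ≥0 Δ) :
    ∃ l₁ α l₂, l = l₁ ++ α :: l₂ ∧ reflectionProd B l₂ β = α := by
  induction l with
  | nil => exact absurd hpos hneg
  | cons v l ih =>
    have hl' : ∀ w ∈ l, w ∈ Δ := fun w hw => hl w (by simp [hw])
    -- If the tail keeps `β` positive, the reflection in `v` is what makes it negative, and the only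
    -- positive root this reflection makes negative is `v`.
    by_cases h : reflectionProd B l β ∈ Submodule.span ℝ≥0 Δ
    · refine ⟨[], v, l, rfl, ?_⟩
      by_contra hne
      rw [reflectionProd_cons] at hneg
      exact hneg (D.rootReflection_mem_cone (hl v (by simp))
        (D.reflectionProd_mem_roots (fun w hw => D.simpleSystem.subset (hl' w hw)) hβ) h hne)
    · obtain ⟨l₁, α, l₂, rfl, h2⟩ := ih hl' h
      exact ⟨v :: l₁, α, l₂, rfl, h2⟩

/-- The exchange condition. -/
theorem exists_exchange (D : IsRootDatum W B Φ Δ) {l : List V} (hl : ∀ v ∈ l, v ∈ Δ) {β : V}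
    (hβ : β ∈ Φ) (hpos : β ∈ Submodule.span ℝ≥0 Δ)
    (hneg : reflectionProd B l β ∉ Submodule.span ℝ≥0 Δ) :
    ∃ l' : List V, (∀ v ∈ l', v ∈ Δ) ∧ l'.length < l.length ∧
      reflectionProd B l * rootReflection B β = reflectionProd B l' := by
  obtain ⟨l₁, α, l₂, rfl, rfl⟩ := D.exists_split hl hβ hpos hneg
  refine ⟨l₁ ++ l₂, fun v hv => hl v ?_, by simp, ?_⟩
  · simp only [List.mem_append, List.mem_cons] at hv ⊢
    tauto
  -- As `l₂` sends `β` to `α`, the factor for `α` is the conjugate by `l₂` of the reflection in `β`;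
  -- multiplying by the latter cancels that factor.
  · rw [reflectionProd_append, reflectionProd_append, reflectionProd_cons,
      ← conj_rootReflection (reflectionProd_isometry D.symm l₂)]
    simp only [mul_assoc, inv_mul_cancel_left, rootReflection_mul_self, mul_one]

/-- A product of simple reflections which fixes a dominant vector lies in the subgroup generated
by the simple reflections that fix it. -/
theorem reflectionProd_mem_of_fixes (D : IsRootDatum W B Φ Δ) {y : V} (hy : ∀ δ ∈ Δ, 0 ≤ B y δ)
    (l : List V) (hl : ∀ v ∈ l, v ∈ Δ) (hfix : reflectionProd B l y = y) :
    reflectionProd B l ∈ reflectionSubgroup B {δ ∈ Δ | B y δ = 0} := by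
  induction hn : l.length using Nat.strong_induction_on generalizing l with
  | _ n ih =>
    subst hn
    rcases List.eq_nil_or_concat l with rfl | ⟨l', α, rfl⟩
    · exact Subgroup.one_mem _
    rw [List.concat_eq_append] at *
    have hl' : ∀ v ∈ l', v ∈ Δ := fun v hv => hl v (by simp [hv])
    have hα : α ∈ Δ := hl α (by simp)
    have hαΦ := D.simpleSystem.subset hα
    have hprod : reflectionProd B (l' ++ [α]) = reflectionProd B l' * rootReflection B α := by
      rw [reflectionProd_append, reflectionProd_cons, reflectionProd_nil, mul_one]
    have happ : reflectionProd B (l' ++ [α]) α = -reflectionProd B l' α := by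
      rw [hprod]
      change reflectionProd B l' (rootReflection B α α) = _
      rw [rootReflection_self (D.self_pos hαΦ).ne', map_neg]
    -- If `l'` keeps `α` positive, the whole word makes it negative; since the word fixes `y`,
    -- invariance gives `B y α ≤ 0`, so `α` is orthogonal to `y` and can be split off. Otherwise the
    -- exchange condition yields a shorter word for the same element.
    by_cases hneg : reflectionProd B l' α ∈ Submodule.span ℝ≥0 Δ
    · have hyα : B y α = 0 := by
        refine le_antisymm ?_ (hy α hα)
        have h1 := Module.Dual.nonneg_of_mem_span_nnreal (f := B y) hy hneg
        have h2 := reflectionProd_isometry D.symm (l' ++ [α]) y α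
        rw [hfix, happ, map_neg] at h2
        linarith
      have hyα' : rootReflection B α y = y :=
        (rootReflection_eq_self_iff (D.self_pos hαΦ).ne').2 hyα
      rw [hprod] at hfix ⊢
      refine Subgroup.mul_mem _ (ih l'.length (by simp) l' hl' ?_ rfl)
        (rootReflection_mem_reflectionSubgroup ⟨hα, hyα⟩)
      change reflectionProd B l' (rootReflection B α y) = y at hfix
      rwa [hyα'] at hfix
    · obtain ⟨l'', hl'', hlen, heq⟩ :=
        D.exists_exchange hl' hαΦ (Submodule.subset_span hα) hneg
      rw [hprod, heq] at hfix ⊢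
      exact ih l''.length (by simp; omega) l'' hl'' hfix rfl

/-- The stabilizer of a dominant vector is generated by the simple reflections that fix it. -/
theorem fixes_iff (D : IsRootDatum W B Φ Δ) {y : V} (hy : ∀ δ ∈ Δ, 0 ≤ B y δ)
    {g : V ≃ₗ[ℝ] V} (hg : g ∈ W) :
    g y = y ↔ g ∈ reflectionSubgroup B {δ ∈ Δ | B y δ = 0} := by
  constructor
  · intro h
    rw [← D.reflectionSubgroup_simple] at hg
    obtain ⟨l, hl, rfl⟩ := exists_reflectionProd_eq hg
    exact D.reflectionProd_mem_of_fixes hy l hl h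
  · intro h
    refine (reflectionSubgroup_le (G := MulAction.stabilizer (V ≃ₗ[ℝ] V) y) ?_ h)
    intro δ hδ
    exact (rootReflection_eq_self_iff (D.self_pos (D.simpleSystem.subset hδ.1)).ne').2 hδ.2

/-- Every vector can be moved into the closed fundamental chamber. -/
theorem exists_dominant [Finite W] (D : IsRootDatum W B Φ Δ) (x : V) :
    ∃ w ∈ W, ∀ δ ∈ Δ, 0 ≤ B (w x) δ := by
  obtain ⟨f, hf⟩ := D.exists_height
  -- Take the point of the orbit of greatest height: a negative product with `δ` would let the
  -- reflection in `δ` raise it.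
  obtain ⟨w, hw⟩ := Finite.exists_max fun w : W => f ((w : V ≃ₗ[ℝ] V) x)
  refine ⟨w, w.2, fun δ hδ => ?_⟩
  have hδΦ := D.simpleSystem.subset hδ
  have h := hw (⟨rootReflection B δ, D.rootReflection_mem hδΦ⟩ * w)
  change f (rootReflection B δ ((w : V ≃ₗ[ℝ] V) x)) ≤ f ((w : V ≃ₗ[ℝ] V) x) at h
  rw [rootReflection_apply, map_sub, map_smul, hf δ hδ] at h
  simp only [smul_eq_mul, mul_one] at h
  by_contra! hlt
  have : 2 * B ((w : V ≃ₗ[ℝ] V) x) δ / B δ δ < 0 := div_neg_of_neg_of_pos (by linarith)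
    (D.self_pos hδΦ)
  linarith

end IsRootDatum

/-! ### Isotropy groups of subspaces -/

section Isotropy

variable {V : Type*} [AddCommGroup V] [Module ℝ V] {W : Subgroup (V ≃ₗ[ℝ] V)}

theorem mem_map_conj_iff {G : Type*} [Group G] {H : Subgroup G} {w g : G} :
    g ∈ H.map (MulAut.conj w).toMonoidHom ↔ w⁻¹ * g * w ∈ H := by
  constructor
  · rintro ⟨h, hh, rfl⟩
    have : w⁻¹ * (w * h * w⁻¹) * w = h := by group
    change w⁻¹ * (w * h * w⁻¹) * w ∈ H
    rwa [this]
  · intro h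
    refine ⟨_, h, ?_⟩
    change w * (w⁻¹ * g * w) * w⁻¹ = g
    group

theorem isotropyGroup_map (w : W) (X : Submodule ℝ V) :
    isotropyGroup W (X.map ((w : V ≃ₗ[ℝ] V) : V →ₗ[ℝ] V)) =
      (isotropyGroup W X).map (MulAut.conj w).toMonoidHom := by
  have hinv : ∀ y, (w : V ≃ₗ[ℝ] V) ((w : V ≃ₗ[ℝ] V)⁻¹ y) = y :=
    (w : V ≃ₗ[ℝ] V).apply_symm_apply
  have hinv' : ∀ y, (w : V ≃ₗ[ℝ] V)⁻¹ ((w : V ≃ₗ[ℝ] V) y) = y :=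
    (w : V ≃ₗ[ℝ] V).symm_apply_apply
  ext g
  rw [mem_map_conj_iff, mem_isotropyGroup, mem_isotropyGroup]
  constructor
  · intro h v hv
    change (w : V ≃ₗ[ℝ] V)⁻¹ ((g : V ≃ₗ[ℝ] V) ((w : V ≃ₗ[ℝ] V) v)) = v
    rw [show (g : V ≃ₗ[ℝ] V) ((w : V ≃ₗ[ℝ] V) v) = (w : V ≃ₗ[ℝ] V) v from h _ ⟨v, hv, rfl⟩, hinv']
  · rintro h _ ⟨v, hv, rfl⟩
    have : (w : V ≃ₗ[ℝ] V)⁻¹ ((g : V ≃ₗ[ℝ] V) ((w : V ≃ₗ[ℝ] V) v)) = v := h v hv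
    change (g : V ≃ₗ[ℝ] V) ((w : V ≃ₗ[ℝ] V) v) = (w : V ≃ₗ[ℝ] V) v
    rw [← hinv ((g : V ≃ₗ[ℝ] V) _), this]

/-- A subspace in the Coxeter arrangement system is the fixed space of its isotropy group. -/
theorem mem_iff_forall_isotropyGroup {X : Submodule ℝ V} (hX : X ∈ coxeterSystem W) {v : V} :
    v ∈ X ↔ ∀ g ∈ isotropyGroup W X, (g : V ≃ₗ[ℝ] V) v = v := by
  refine ⟨fun hv g hg => mem_isotropyGroup.1 hg v hv, fun h => ?_⟩
  obtain ⟨A, hA, rfl⟩ := hX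
  rw [Submodule.mem_sInf]
  intro Y hY
  obtain ⟨s, hs, -, rfl⟩ := hA hY
  refine h ⟨s, hs⟩ (mem_isotropyGroup.2 fun u hu => ?_)
  exact Submodule.mem_sInf.1 hu _ hY

theorem injOn_isotropyGroup (W : Subgroup (V ≃ₗ[ℝ] V)) :
    Set.InjOn (isotropyGroup W) (coxeterSystem W) := by
  intro X hX Y hY h
  ext v
  rw [mem_iff_forall_isotropyGroup hX, mem_iff_forall_isotropyGroup hY, h]

/-- For a finite group, some vector of `X` has the same isotropy group as `X`. -/
theorem exists_isotropyGroup_eq [Finite W] (X : Submodule ℝ V) :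
    ∃ x ∈ X, ∀ g : W, g ∈ isotropyGroup W X ↔ (g : V ≃ₗ[ℝ] V) x = x := by
  -- Each element outside `W_X` fixes only a proper subspace of `X`, and finitely many proper
  -- subspaces cannot cover a real vector space.
  let p : {g : W // g ∉ isotropyGroup W X} → Submodule ℝ X := fun g =>
    (LinearMap.fixedSubmodule ((g.1 : V ≃ₗ[ℝ] V) : V →ₗ[ℝ] V)).comap X.subtype
  obtain ⟨x, hx⟩ := Submodule.exists_forall_notMem_of_forall_ne_top p fun g htop => by
    refine g.2 (mem_isotropyGroup.2 fun v hv => ?_)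
    have : (⟨v, hv⟩ : X) ∈ p g := htop ▸ Submodule.mem_top
    exact this
  refine ⟨x, x.2, fun g => ⟨fun h => mem_isotropyGroup.1 h x x.2, fun h => ?_⟩⟩
  by_contra hg
  exact hx ⟨g, hg⟩ h

end Isotropy

/-! ### Isotropy groups are the parabolic subgroups -/

namespace IsRootDatum

variable {V : Type*} [AddCommGroup V] [Module ℝ V]
  {W : Subgroup (V ≃ₗ[ℝ] V)} {B : LinearMap.BilinForm ℝ V} {Φ Δ : Set V}

theorem isotropyGroup_mem_parabolicSubgroups [Finite W] (D : IsRootDatum W B Φ Δ)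
    (X : Submodule ℝ V) : isotropyGroup W X ∈ parabolicSubgroups W B Δ := by
  obtain ⟨x, -, hx⟩ := exists_isotropyGroup_eq (W := W) X
  obtain ⟨w, hw, hdom⟩ := D.exists_dominant x
  -- The stabilizer of the dominant vector `w x` is special parabolic; conjugating by `w⁻¹` gives
  -- the stabilizer of `x`.
  refine ⟨{δ ∈ Δ | B (w x) δ = 0}, fun δ hδ => hδ.1, (⟨w, hw⟩ : W)⁻¹, ?_⟩
  ext g
  rw [hx, mem_map_conj_iff, inv_inv, specialParabolic, Subgroup.mem_subgroupOf,
    ← D.fixes_iff hdom (SetLike.coe_mem _)]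
  have hinv' : w⁻¹ (w x) = x := w.symm_apply_apply x
  change _ ↔ w ((g : V ≃ₗ[ℝ] V) (w⁻¹ (w x))) = w x
  rw [hinv', w.injective.eq_iff]

/-- Positive definiteness makes `B` injective as a map to the dual, and equality of dimensions makes
it surjective. -/
theorem exists_dual_vector [FiniteDimensional ℝ V] (D : IsRootDatum W B Φ Δ)
    (f : Module.Dual ℝ V) : ∃ y, ∀ v, B y v = f v := by
  have hinj : LinearMap.ker B = ⊥ := by
    rw [LinearMap.ker_eq_bot']
    intro y hy
    by_contra hne
    have := D.innerProduct.2 y hne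
    rw [hy] at this
    exact lt_irrefl _ this
  have hsurj : Function.Surjective B :=
    (LinearMap.injective_iff_surjective_of_finrank_eq_finrank
      Subspace.dual_finrank_eq.symm).1 (LinearMap.ker_eq_bot.1 hinj)
  obtain ⟨y, hy⟩ := hsurj f
  exact ⟨y, fun v => by rw [hy]⟩

/-- A vector that is orthogonal to the simple roots in `I` and has positive inner product with all
the other simple roots. -/
theorem exists_dominant_vector [FiniteDimensional ℝ V] (D : IsRootDatum W B Φ Δ) (I : Set V) :
    ∃ y, (∀ δ ∈ Δ, δ ∈ I → B y δ = 0) ∧ ∀ δ ∈ Δ, δ ∉ I → 0 < B y δ := by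
  classical
  let b := Module.Basis.extend D.simpleSystem.linearIndepOn
  obtain ⟨y, hy⟩ := D.exists_dual_vector (b.constr ℝ fun i => if i.1 ∈ I then (0 : ℝ) else 1)
  have key : ∀ δ ∈ Δ, B y δ = if δ ∈ I then (0 : ℝ) else 1 := fun δ hδ => by
    have hb := Module.Basis.extend_apply_self D.simpleSystem.linearIndepOn
      ⟨δ, D.simpleSystem.linearIndepOn.subset_extend _ hδ⟩
    have := b.constr_basis ℝ (fun i => if i.1 ∈ I then (0 : ℝ) else 1)
      ⟨δ, D.simpleSystem.linearIndepOn.subset_extend _ hδ⟩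
    rw [hy]
    simpa only [b, hb] using this
  refine ⟨y, fun δ hδ h => ?_, fun δ hδ h => ?_⟩
  · rw [key δ hδ, if_pos h]
  · rw [key δ hδ, if_neg h]
    exact one_pos

/-- A special parabolic subgroup `W_I` is the isotropy group of the common fixed space of the
reflections in the roots of `I`. -/
theorem exists_isotropyGroup_eq_specialParabolic [FiniteDimensional ℝ V]
    (D : IsRootDatum W B Φ Δ) {I : Set V} (hI : I ⊆ Δ) :
    ∃ X ∈ coxeterSystem W, isotropyGroup W X = specialParabolic W B I := by
  have hIΦ : ∀ v ∈ I, v ∈ Φ := fun v hv => D.simpleSystem.subset (hI hv)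
  let X : Submodule ℝ V := sInf ((fun v => LinearMap.fixedSubmodule
    (rootReflection B v : V →ₗ[ℝ] V)) '' I)
  have hmem : ∀ y, y ∈ X ↔ ∀ v ∈ I, rootReflection B v y = y := fun y => by
    simp [X, Submodule.mem_sInf]
  refine ⟨X, ⟨_, ?_, rfl⟩, le_antisymm ?_ ?_⟩
  · rintro _ ⟨v, hv, rfl⟩
    exact ⟨_, D.rootReflection_mem (hIΦ v hv),
      isLinearReflection_rootReflection (D.self_pos (hIΦ v hv)).ne', rfl⟩
  -- This single vector of `X` suffices: it is dominant and the simple roots orthogonal to it are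
  -- exactly `I`, so its stabilizer is already `W_I`.
  · obtain ⟨y, hy0, hy1⟩ := D.exists_dominant_vector I
    have hdom : ∀ δ ∈ Δ, 0 ≤ B y δ := fun δ hδ => by
      by_cases h : δ ∈ I
      · rw [hy0 δ hδ h]
      · exact (hy1 δ hδ h).le
    have hyX : y ∈ X := (hmem y).2 fun v hv =>
      (rootReflection_eq_self_iff (D.self_pos (hIΦ v hv)).ne').2 (hy0 v (hI hv) hv)
    have hset : {δ ∈ Δ | B y δ = 0} = I := by
      ext δ
      refine ⟨fun h => ?_, fun h => ⟨hI h, hy0 δ (hI h) h⟩⟩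
      by_contra hδ
      exact (hy1 δ h.1 hδ).ne' h.2
    intro g hg
    rw [specialParabolic, Subgroup.mem_subgroupOf, ← hset, ← D.fixes_iff hdom g.2]
    exact mem_isotropyGroup.1 hg y hyX
  · intro g hg
    refine mem_isotropyGroup.2 fun y hy => ?_
    exact reflectionSubgroup_le (G := MulAction.stabilizer (V ≃ₗ[ℝ] V) y)
      (fun v hv => (hmem y).1 hy v hv) hg

theorem bijOn_isotropyGroup [FiniteDimensional ℝ V] [Finite W] (D : IsRootDatum W B Φ Δ) :
    Set.BijOn (isotropyGroup W) (coxeterSystem W) (parabolicSubgroups W B Δ) := by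
  refine ⟨fun X _ => D.isotropyGroup_mem_parabolicSubgroups X, injOn_isotropyGroup W, ?_⟩
  rintro _ ⟨I, hI, w, rfl⟩
  obtain ⟨X, hX, h⟩ := D.exists_isotropyGroup_eq_specialParabolic hI
  exact ⟨_, (isSystem_coxeterSystem W).map_mem w w.2 X hX, by rw [isotropyGroup_map, h]⟩

end IsRootDatum

/-! ### Counting restrictions by cosets -/

section Count

variable {V : Type*} [AddCommGroup V] [Module ℝ V]

theorem restrict_eq_restrict_iff {W : Subgroup (V ≃ₗ[ℝ] V)} {g h : W} {X : Submodule ℝ V} :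
    PartialLinearIso.restrict (g : V ≃ₗ[ℝ] V) X = PartialLinearIso.restrict (h : V ≃ₗ[ℝ] V) X ↔
      (g : W ⧸ isotropyGroup W X) = h := by
  rw [QuotientGroup.eq, mem_isotropyGroup]
  have key : ∀ v, ((g⁻¹ * h : W) : V ≃ₗ[ℝ] V) v = v ↔
      (g : V ≃ₗ[ℝ] V) v = (h : V ≃ₗ[ℝ] V) v := fun v => by
    change (g : V ≃ₗ[ℝ] V).symm ((h : V ≃ₗ[ℝ] V) v) = v ↔ _
    rw [LinearEquiv.symm_apply_eq, eq_comm]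
  simp only [key]
  constructor
  · intro heq v hv
    have hval : ∀ (a b : PartialLinearIso ℝ V) (_ : a = b) (ha : v ∈ a.dom) (hb : v ∈ b.dom),
        (a.equiv ⟨v, ha⟩ : V) = b.equiv ⟨v, hb⟩ := by
      rintro a _ rfl _ _
      rfl
    exact hval _ _ heq hv hv
  · intro hv
    exact PartialLinearIso.ext' rfl fun x hx _ => hv x hx

/-- A restriction determines its domain `X`, and then the group element up to a coset of `W_X`;
hence the bijection with the disjoint union of coset spaces. -/
theorem card_partialIsoMonoid {W : Subgroup (V ≃ₗ[ℝ] V)} [Finite W] {S : Set (Submodule ℝ V)}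
    (hS : IsSystem W S) (hfin : S.Finite) :
    Nat.card (partialIsoMonoid W S hS) = ∑ᶠ X ∈ S, (isotropyGroup W X).index := by
  have : Fintype S := hfin.fintype
  let φ : (Σ X : S, W ⧸ isotropyGroup W X.1) → partialIsoMonoid W S hS := fun a =>
    Quotient.liftOn' a.2
      (fun g => ⟨PartialLinearIso.restrict (g : V ≃ₗ[ℝ] V) a.1, g, g.2, a.1, a.1.2, rfl⟩)
      fun g h hgh => Subtype.ext (restrict_eq_restrict_iff.2 (Quotient.sound' hgh))
  have hφ : Function.Bijective φ := by
    constructor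
    · rintro ⟨X, a⟩ ⟨Y, b⟩ h
      induction a using QuotientGroup.induction_on with | _ g
      induction b using QuotientGroup.induction_on with | _ g'
      have h' : PartialLinearIso.restrict (g : V ≃ₗ[ℝ] V) X.1 =
          PartialLinearIso.restrict (g' : V ≃ₗ[ℝ] V) Y.1 := congrArg Subtype.val h
      obtain rfl : X = Y := Subtype.ext (congrArg PartialLinearIso.dom h')
      rw [restrict_eq_restrict_iff.1 h']
    · rintro ⟨_, g, hg, X, hX, rfl⟩
      exact ⟨⟨⟨X, hX⟩, ((⟨g, hg⟩ : W) : W ⧸ isotropyGroup W X)⟩, rfl⟩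
  rw [← Nat.card_congr (Equiv.ofBijective φ hφ), Nat.card_sigma,
    ← finsum_set_coe_eq_finsum_mem, finsum_eq_sum_of_fintype]
  rfl

end Count

/-! ### Existence of a root datum -/

section Existence

variable {V : Type*} [AddCommGroup V] [Module ℝ V] {B : LinearMap.BilinForm ℝ V}

theorem exists_isInnerProduct (V : Type*) [AddCommGroup V] [Module ℝ V] [FiniteDimensional ℝ V] :
    ∃ B : LinearMap.BilinForm ℝ V, IsInnerProduct B := by
  let b := Module.finBasis ℝ V
  let B : LinearMap.BilinForm ℝ V :=
    ∑ i, (LinearMap.mul ℝ ℝ).compl₁₂ (b.coord i) (b.coord i)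
  have hB : ∀ x y, B x y = ∑ i, b.coord i x * b.coord i y := fun x y => by
    simp [B, LinearMap.sum_apply]
  refine ⟨B, fun x y => ?_, fun x hx => ?_⟩
  · simp only [hB, mul_comm]
  · obtain ⟨i, hi⟩ : ∃ i, b.coord i x ≠ 0 := by
      by_contra! h
      exact hx (b.ext_elem fun i => by simpa using h i)
    rw [hB]
    exact Finset.sum_pos' (fun j _ => mul_self_nonneg _)
      ⟨i, Finset.mem_univ i, mul_self_pos.2 hi⟩

/-- A finite linear group preserves an inner product. -/
theorem exists_invariant_isInnerProduct [FiniteDimensional ℝ V] (W : Subgroup (V ≃ₗ[ℝ] V))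
    [Finite W] : ∃ B : LinearMap.BilinForm ℝ V, IsInnerProduct B ∧
      ∀ g ∈ W, ∀ x y, B (g x) (g y) = B x y := by
  have : Fintype W := Fintype.ofFinite W
  obtain ⟨B₀, hsymm, hpos⟩ := exists_isInnerProduct V
  let B : LinearMap.BilinForm ℝ V :=
    ∑ g : W, B₀.compl₁₂ ((g : V ≃ₗ[ℝ] V) : V →ₗ[ℝ] V) ((g : V ≃ₗ[ℝ] V) : V →ₗ[ℝ] V)
  have hB : ∀ x y, B x y = ∑ g : W, B₀ ((g : V ≃ₗ[ℝ] V) x) ((g : V ≃ₗ[ℝ] V) y) := fun x y => by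
    simp [B, LinearMap.sum_apply]
  refine ⟨B, ⟨fun x y => ?_, fun x hx => ?_⟩, fun g hg x y => ?_⟩
  · rw [hB, hB]
    exact Finset.sum_congr rfl fun g _ => hsymm _ _
  · rw [hB]
    exact Finset.sum_pos (fun g _ => hpos _ (by simpa using hx)) ⟨1, Finset.mem_univ _⟩
  · rw [hB, hB]
    -- Right translation by `g` permutes the summands of the average.
    exact Fintype.sum_equiv (Equiv.mulRight (⟨g, hg⟩ : W)) _ _ fun _ => rfl

/-- Since `s x = -x`, comparing `B (s y) (s x)` with `B y x` forces `f y = 2 * B y x / B x x`;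
rescaling `x` to unit length does not change the reflection. -/
theorem IsLinearReflection.exists_eq_rootReflection (hB : IsInnerProduct B) {s : V ≃ₗ[ℝ] V}
    (hs : IsLinearReflection s) (hinv : ∀ x y, B (s x) (s y) = B x y) :
    ∃ v, B v v = 1 ∧ s = rootReflection B v := by
  obtain ⟨x, f, h, rfl⟩ := hs
  have hx : x ≠ 0 := by
    rintro rfl
    simp at h
  have hpos := hB.2 x hx
  have hs : Module.reflection h = rootReflection B x := by
    ext y
    have := hinv y x
    rw [Module.reflection_apply_self, Module.reflection_apply] at this
    simp only [map_sub, map_neg, map_smul, LinearMap.sub_apply, LinearMap.smul_apply,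
      smul_eq_mul] at this
    rw [Module.reflection_apply, rootReflection_apply]
    congr 2
    rw [eq_div_iff hpos.ne']
    linarith
  refine ⟨(√(B x x))⁻¹ • x, ?_, ?_⟩
  · simp only [map_smul, LinearMap.smul_apply, smul_eq_mul]
    rw [← mul_assoc, ← mul_inv, Real.mul_self_sqrt hpos.le, inv_mul_cancel₀ hpos.ne']
  · rw [hs, rootReflection_smul (inv_ne_zero (Real.sqrt_pos.2 hpos).ne')]

/-- The unit vectors whose reflections lie in `W`. -/
def unitRoots (B : LinearMap.BilinForm ℝ V) (W : Subgroup (V ≃ₗ[ℝ] V)) : Set V :=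
  {v | B v v = 1 ∧ rootReflection B v ∈ W}

theorem eq_or_eq_neg_of_rootReflection_eq {u v : V} (hu : B u u = 1) (hv : B v v = 1)
    (h : rootReflection B v = rootReflection B u) : v = u ∨ v = -u := by
  have h1 : rootReflection B v v = rootReflection B u v := by rw [h]
  rw [rootReflection_self (by rw [hv]; exact one_ne_zero), rootReflection_apply, hu, div_one] at h1
  have h2 : v = B v u • u := by
    have : (2 : ℝ) • v = (2 : ℝ) • (B v u • u) := by
      rw [smul_smul, two_smul]
      nth_rewrite 2 [← neg_neg v]
      rw [h1]
      abel
    exact smul_right_injective V (two_ne_zero (α := ℝ)) this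
  have h3 : B v u * B v u = 1 := by
    have : B (B v u • u) (B v u • u) = 1 := by rw [← h2, hv]
    simpa [hu] using this
  rcases mul_self_eq_one_iff.1 h3 with hc | hc
  · left; rw [h2, hc, one_smul]
  · right; rw [h2, hc, neg_one_smul]

/-- Unit length leaves only `±v` on a line. A reflection determines its unit root up to sign, so
finiteness of `W` bounds the roots. -/
theorem isRootSystem_unitRoots {W : Subgroup (V ≃ₗ[ℝ] V)} [Finite W]
    (hinv : ∀ g ∈ W, ∀ x y, B (g x) (g y) = B x y) : IsRootSystem B (unitRoots B W) where
  finite := by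
    refine Set.Finite.of_finite_fibers (f := rootReflection B)
      ((Set.toFinite (W : Set (V ≃ₗ[ℝ] V))).subset ?_) ?_
    · rintro _ ⟨v, hv, rfl⟩
      exact hv.2
    · rintro _ ⟨u, hu, rfl⟩
      refine (Set.toFinite {u, -u}).subset ?_
      rintro v ⟨hv, h⟩
      exact eq_or_eq_neg_of_rootReflection_eq hu.1 hv.1 h
  zero_notMem := fun h => by simpa using h.1
  line := by
    intro v hv
    ext u
    constructor
    · rintro ⟨hu, hspan⟩
      obtain ⟨c, rfl⟩ := Submodule.mem_span_singleton.1 hspan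
      have : c * c = 1 := by simpa [hv.1] using hu.1
      rcases mul_self_eq_one_iff.1 this with rfl | rfl <;> simp
    · rintro (rfl | rfl)
      · exact ⟨hv, Submodule.mem_span_singleton_self _⟩
      · exact ⟨⟨by simpa using hv.1, by rw [rootReflection_neg]; exact hv.2⟩,
          Submodule.neg_mem _ (Submodule.mem_span_singleton_self _)⟩
  reflection_mem := by
    intro v hv s hs
    obtain rfl := isReflectionOf_iff.1 hs
    have hmem : ∀ u ∈ unitRoots B W, rootReflection B v u ∈ unitRoots B W := fun u hu =>
      ⟨by rw [hinv _ hv.2]; exact hu.1, by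
        rw [← conj_rootReflection (hinv _ hv.2)]
        exact W.mul_mem (W.mul_mem hv.2 hu.2) (W.inv_mem hv.2)⟩
    apply Set.Subset.antisymm
    · rintro _ ⟨u, hu, rfl⟩
      exact hmem u hu
    · exact fun u hu => ⟨_, hmem u hu, rootReflection_apply_apply v u⟩

theorem reflectionSubgroup_unitRoots {W : Subgroup (V ≃ₗ[ℝ] V)} (hB : IsInnerProduct B)
    (hinv : ∀ g ∈ W, ∀ x y, B (g x) (g y) = B x y) (hW : IsReflectionGroup W) :
    reflectionSubgroup B (unitRoots B W) = W := by
  apply le_antisymm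
  · exact reflectionSubgroup_le fun v hv => hv.2
  · obtain ⟨R, hR, hcl⟩ := hW
    have hRW : R ⊆ W := hcl ▸ Subgroup.subset_closure
    refine hcl.ge.trans ((Subgroup.closure_le _).2 fun s hs => ?_)
    obtain ⟨v, hv, rfl⟩ := (hR s hs).exists_eq_rootReflection hB (hinv s (hRW hs))
    exact rootReflection_mem_reflectionSubgroup ⟨hv, hRW hs⟩

/-- Distinct elements of a minimal generating set of the cone of positive roots subtend an obtuse
angle. -/
theorem IsRootSystem.nonpos_of_minimal {Φ Δ : Set V} (hB : IsInnerProduct B)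
    (hΦ : IsRootSystem B Φ) {f : Module.Dual ℝ V} (hf : ∀ v ∈ Φ, f v ≠ 0) (hΔΦ : Δ ⊆ Φ)
    (hpos : ∀ δ ∈ Δ, 0 < f δ) (hspan : ∀ v ∈ Φ, 0 < f v → v ∈ Submodule.span ℝ≥0 Δ)
    (hmin : ∀ δ ∈ Δ, δ ∉ Submodule.span ℝ≥0 (Δ \ {δ})) {a b : V} (ha : a ∈ Δ) (hb : b ∈ Δ)
    (hne : a ≠ b) : B a b ≤ 0 := by
  have key : ∀ δ ∈ Δ, ∀ r : ℝ, ∀ z ∈ Submodule.span ℝ≥0 (Δ \ {δ}), r • δ = z → ¬ 0 < f z := by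
    rintro δ hδ r z hz rfl hfz
    rw [map_smul, smul_eq_mul] at hfz
    have hr : 0 < r := pos_of_mul_pos_left hfz (hpos δ hδ).le
    have h := Submodule.smul_mem _ (⟨r⁻¹, (inv_pos.2 hr).le⟩ : ℝ≥0) hz
    change r⁻¹ • r • δ ∈ Submodule.span ℝ≥0 (Δ \ {δ}) at h
    rw [inv_smul_smul₀ hr.ne'] at h
    exact hmin δ hδ h
  -- Writing a cone element `r • δ - c • γ` as `t • δ + u`, with `u` in the cone of the other
  -- generators, gives `(r - t) • δ = u + c • γ`, whose right side has positive value under `f`;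
  -- this is excluded by `key`.
  have key' : ∀ δ ∈ Δ, ∀ γ ∈ Δ, γ ≠ δ → ∀ c : ℝ, 0 < c → ∀ r : ℝ, ∀ v ∈ Submodule.span ℝ≥0 Δ,
      v ≠ r • δ - c • γ := by
    rintro δ hδ γ hγ hγδ c hc r v hv rfl
    rw [← Set.insert_sdiff_self_of_mem hδ, Submodule.mem_span_insert] at hv
    obtain ⟨t, u, hu, hv⟩ := hv
    have hγ' : c • γ ∈ Submodule.span ℝ≥0 (Δ \ {δ}) :=
      Submodule.smul_mem _ (⟨c, hc.le⟩ : ℝ≥0) (Submodule.subset_span ⟨hγ, hγδ⟩)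
    refine key δ hδ (r - t) (u + c • γ) (Submodule.add_mem _ hu hγ') ?_ ?_
    · rw [NNReal.smul_def] at hv
      rw [sub_smul, sub_eq_iff_eq_add, eq_add_of_sub_eq hv]
      abel
    · rw [map_add, map_smul]
      have := Module.Dual.nonneg_of_mem_span_nnreal
        (fun γ (hγ : γ ∈ Δ \ {δ}) => (hpos γ hγ.1).le) hu
      exact add_pos_of_nonneg_of_pos this (mul_pos hc (hpos γ hγ))
  by_contra! hab
  have hc : 0 < 2 * B b a / B a a := by
    rw [hB.1 b a]
    refine div_pos (by linarith) (hB.2 a ?_)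
    rintro rfl
    simpa using hpos _ ha
  have hs : rootReflection B a b ∈ Φ := by
    rw [← hΦ.reflection_mem a (hΔΦ ha) _ (isReflectionOf_iff.2 rfl)]
    exact ⟨b, hΔΦ hb, rfl⟩
  have hneg : -rootReflection B a b ∈ Φ := by
    have : -rootReflection B a b ∈ Φ ∩ (Submodule.span ℝ {rootReflection B a b} : Set V) := by
      rw [hΦ.line _ hs]
      simp
    exact this.1
  -- Whichever of `±` the reflected root is positive, it lies in the cone but has the shape ruled
  -- out by `key'`, with the roles of `a` and `b` depending on the sign.
  rcases (hf _ hs).lt_or_gt with h | h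
  · refine key' a ha b hb hne.symm 1 one_pos (2 * B b a / B a a) _
      (hspan _ hneg (by rw [map_neg]; linarith)) ?_
    rw [rootReflection_apply, one_smul]
    abel
  · refine key' b hb a ha hne _ hc 1 _ (hspan _ hs h) ?_
    rw [rootReflection_apply, one_smul]

/-- A functional vanishing on no root selects the positive ones. A minimal subset generating their
cone is pairwise non-acute and lies in an open half-space, which forces linear independence. -/
theorem IsRootSystem.exists_isSimpleSystem {Φ : Set V} (hB : IsInnerProduct B)
    (hΦ : IsRootSystem B Φ) : ∃ Δ, IsSimpleSystem Φ Δ := by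
  have := hΦ.finite.to_subtype
  obtain ⟨f, hf⟩ := Module.exists_dual_forall_apply_ne_zero (K := ℝ) (fun v : Φ => (v : V))
    fun v hv => hΦ.zero_notMem (hv ▸ v.2)
  replace hf : ∀ v ∈ Φ, f v ≠ 0 := fun v hv => hf ⟨v, hv⟩
  let P : Set V := {v ∈ Φ | 0 < f v}
  let T : Set (Set V) := {D | D ⊆ P ∧ P ⊆ Submodule.span ℝ≥0 D}
  have hT : T.Finite := (hΦ.finite.subset (Set.sep_subset _ _)).finite_subsets.subset
    fun D hD => hD.1
  obtain ⟨Δ, ⟨hΔP, hPΔ⟩, hmin⟩ := hT.exists_minimal ⟨P, subset_rfl, Submodule.subset_span⟩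
  have hΔΦ : Δ ⊆ Φ := fun δ hδ => (hΔP hδ).1
  have hmin' : ∀ δ ∈ Δ, δ ∉ Submodule.span ℝ≥0 (Δ \ {δ}) := by
    intro δ hδ h
    have hle : Submodule.span ℝ≥0 Δ ≤ Submodule.span ℝ≥0 (Δ \ {δ}) := by
      rw [Submodule.span_le]
      intro γ hγ
      rcases eq_or_ne γ δ with rfl | hne
      · exact h
      · exact Submodule.subset_span ⟨hγ, hne⟩
    have := hmin (y := Δ \ {δ}) ⟨Set.sdiff_subset.trans hΔP, fun v hv => hle (hPΔ hv)⟩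
      Set.sdiff_subset hδ
    exact this.2 rfl
  refine ⟨Δ, hΔΦ, ?_, fun v hv => ?_⟩
  · refine LinearMap.BilinForm.linearIndependent_of_pairwise_le_zero B
      (fun x hx => hB.2 x hx) f _ (fun δ => (hΔP δ.2).2) fun a b hab => ?_
    exact hΦ.nonpos_of_minimal hB hf hΔΦ (fun δ hδ => (hΔP hδ).2)
      (fun v hv h => hPΔ ⟨hv, h⟩) hmin' a.2 b.2 (Subtype.coe_injective.ne hab)
  · rcases (hf v hv).lt_or_gt with h | h
    · have hneg : -v ∈ Φ := by
        have : -v ∈ Φ ∩ (Submodule.span ℝ {v} : Set V) := by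
          rw [hΦ.line _ hv]
          simp
        exact this.1
      exact .inr (hPΔ ⟨hneg, by rw [map_neg]; linarith⟩)
    · exact .inl (hPΔ ⟨hv, h⟩)

theorem IsReflectionGroup.exists_isRootDatum [FiniteDimensional ℝ V] {W : Subgroup (V ≃ₗ[ℝ] V)}
    [Finite W] (hW : IsReflectionGroup W) :
    ∃ (B : LinearMap.BilinForm ℝ V) (Φ Δ : Set V), IsRootDatum W B Φ Δ := by
  obtain ⟨B, hB, hinv⟩ := exists_invariant_isInnerProduct W
  have hΦ := isRootSystem_unitRoots hinv
  obtain ⟨Δ, hΔ⟩ := hΦ.exists_isSimpleSystem hB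
  exact ⟨B, _, Δ, hB, hΦ, reflectionSubgroup_unitRoots hB hinv hW, hΔ⟩

end Existence

theorem mainTheorem1 {V : Type*} [AddCommGroup V] [Module ℝ V] [FiniteDimensional ℝ V]
    (W : Subgroup (V ≃ₗ[ℝ] V)) [Finite W] (hW : IsReflectionGroup W) :
    (∃ (B : LinearMap.BilinForm ℝ V) (Φ Δ : Set V), IsRootDatum W B Φ Δ) ∧
    ∀ (B : LinearMap.BilinForm ℝ V) (Φ Δ : Set V), IsRootDatum W B Φ Δ →
      Set.BijOn (isotropyGroup W) (coxeterSystem W) (parabolicSubgroups W B Δ) ∧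
      Nat.card (coxeterArrangementMonoid W) = ∑ᶠ P ∈ parabolicSubgroups W B Δ, P.index := by
  refine ⟨hW.exists_isRootDatum, fun B Φ Δ D => ⟨D.bijOn_isotropyGroup, ?_⟩⟩
  -- The system injects into the finite set of subgroups of `W`.
  have hfin : (coxeterSystem W).Finite :=
    Set.Finite.of_injOn (Set.mapsTo_univ _ _) (injOn_isotropyGroup W) Set.finite_univ
  rw [← finsum_mem_eq_of_bijOn _ D.bijOn_isotropyGroup fun _ _ => rfl]
  exact card_partialIsoMonoid _ hfin
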